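/- **Notation.** Let $\mathcal R$ be the ring of matrices $\begin{bmatrix} b&0\\ c&v\end{bmatrix}$ with $b,c\in\mathbb R$, $v\in\mathbb Z$, identified as a set with $\mathbb C\times\mathbb Z$ through $(b+\sqrt{-1}c,v)$. For $g\in\mathbb C^*$ and $\mu=(b+\sqrt{-1}c,v)\in\mathcal R$ put $g^\mu=|g|^{b+\sqrt{-1}c}(g/|g|)^v$. For $\alpha=(\alpha^1,\dots,\alpha^n)$ and $\beta=(\beta^1,\dots,\beta^n)$ in $\mathcal R^n$ put $\langle\alpha,\beta\rangle=\sum_k\alpha^k\beta^k\in\mathcal R$, $\chi^\alpha(g_1,\dots,g_n)=\prod_k g_k^{\alpha^k}$ and $\lambda_\beta(g)=(g^{\beta^1},\dots,g^{\beta^n})$. A *topological fan* of dimension $n$ is a pair $\Delta=(\Sigma,\beta)$, where $\Sigma$ is an abstract simplicial complex of dimension $n-1$ (containing $\emptyset$) with vertex set $[m]=\{1,\dots,m\}$ and $\beta\colon[m]\to\mathcal R^n=\mathbb C^n\times\mathbb Z^n$, $\beta_i=(b_i+\sqrt{-1}c_i,v_i)$, such that (1) for each $I\in\Sigma$ the $b_i$,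 $i\in I$, are linearly independent, and the cones $\angle b_I$ spanned by $\{b_i\}_{i\in I}$ satisfy $\angle b_I\cap\angle b_J=\angle b_{I\cap J}$ for all $I,J\in\Sigma$; (2) each $v_i$ is primitive and, for each $I\in\Sigma$, the $v_i$, $i\in I$, are linearly independent. It is *complete* if $\bigcup_{I\in\Sigma}\angle b_I=\mathbb R^n$, and *non-singular* if for every $I\in\Sigma$ the $v_i$, $i\in I$, form a part of a $\mathbb Z$-basis of $\mathbb Z^n$. A *topological toric manifold* of dimension $2n$ is a closed smooth manifold of dimension $2n$ with an effective smooth action of $(\mathbb C^*)^n$ having an open dense orbit, which is covered by finitely many invariant open subsets each equivariantly diffeomorphic to a direct sum of complex one-dimensional smooth representation spaces of $(\mathbb C^*)^n$. Given $\Delta$, put $U(I)=\{z\in\mathbb C^m\mid z_i\ne0\text{ for all }i\notin I\}$, $U(\Sigma)=\bigcup_{I\in\Sigma}U(I)$, $\lambda\colon(\mathbb C^*)^m\to(\mathbb C^*)^n$, $\lambda(h)=\prod_{k=1}^m\lambda_{\beta_k}(h_k)$, and $X(\Delta)=U(\Sigma)/\operatorname{Ker}\lambda$ with the quotient topology. Let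 $\Sigma^{(n)}$ be the set of $I\in\Sigma$ with $|I|=n$. **Statement.** Let $\Delta=(\Sigma,\beta)$ be a complete non-singular topological fan of dimension $n$. Then $\lambda$ is surjective, and for every $I\in\Sigma^{(n)}$ there is a unique family $\{\alpha^I_i\}_{i\in I}$ in $\mathcal R^n$ dual to $\{\beta_i\}_{i\in I}$, i.e. $\langle\alpha^I_i,\beta_j\rangle=\delta_{ij}\mathbf 1$ for $i,j\in I$. The action of $(\mathbb C^*)^m$ on $U(\Sigma)$ by coordinatewise multiplication induces, through $\lambda$, an action of $(\mathbb C^*)^n$ on $X(\Delta)$: $\lambda(h)\cdot[z]=[hz]$. For every $I\in\Sigma^{(n)}$ the formula $$\varphi_I([z])=\Big(z_i\prod_{k\notin I}z_k^{\langle\alpha^I_i,\beta_k\rangle}\Big)_{i\in I}$$ defines a homeomorphism from the invariant open set $U(I)/\operatorname{Ker}\lambda\subset X(\Delta)$ onto $\mathbb C^I$, which is $(\mathbb C^*)^n$-equivariant onto the representation space of $\bigoplus_{i\in I}\chi^{\alpha^I_i}$, and this representation is faithful. The transition maps $\varphi_J\circ\varphi_I^{-1}$ are smooth. The space $X(\Delta)$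 is Hausdorff and compact, and with this action and the smooth atlas $\{(U(I)/\operatorname{Ker}\lambda,\varphi_I)\}_{I\in\Sigma^{(n)}}$ it is a topological toric manifold of dimension $2n$. -/

import Mathlib

open scoped Manifold ContDiff

noncomputable section

namespace TopToric

/-- The ring `𝓡` of real `2 × 2` matrices `[[b, 0], [c, v]]` with `b, c ∈ ℝ` and `v ∈ ℤ`.
As a set it is identified with `ℂ × ℤ` through `(b + √-1 c, v)`. -/
@[ext]
structure Exponent where
  b : ℝ
  c : ℝ
  v : ℤ

namespace Exponent

instance : Zero Exponent := ⟨⟨0, 0, 0⟩⟩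

instance : One Exponent := ⟨⟨1, 0, 1⟩⟩

instance : Add Exponent := ⟨fun x y => ⟨x.b + y.b, x.c + y.c, x.v + y.v⟩⟩

instance : Neg Exponent := ⟨fun x => ⟨-x.b, -x.c, -x.v⟩⟩

/-- Matrix multiplication of `[[b₁, 0], [c₁, v₁]]` and `[[b₂, 0], [c₂, v₂]]`. -/
instance : Mul Exponent := ⟨fun x y => ⟨x.b * y.b, x.c * y.b + x.v * y.c, x.v * y.v⟩⟩

@[simp] theorem zero_b : (0 : Exponent).b = 0 := rfl
@[simp] theorem zero_c : (0 : Exponent).c = 0 := rfl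
@[simp] theorem zero_v : (0 : Exponent).v = 0 := rfl
@[simp] theorem one_b : (1 : Exponent).b = 1 := rfl
@[simp] theorem one_c : (1 : Exponent).c = 0 := rfl
@[simp] theorem one_v : (1 : Exponent).v = 1 := rfl
@[simp] theorem add_b (x y : Exponent) : (x + y).b = x.b + y.b := rfl
@[simp] theorem add_c (x y : Exponent) : (x + y).c = x.c + y.c := rfl
@[simp] theorem add_v (x y : Exponent) : (x + y).v = x.v + y.v := rfl
@[simp] theorem neg_b (x : Exponent) : (-x).b = -x.b := rfl
@[simp] theorem neg_c (x : Exponent) : (-x).c = -x.c := rfl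
@[simp] theorem neg_v (x : Exponent) : (-x).v = -x.v := rfl
@[simp] theorem mul_b (x y : Exponent) : (x * y).b = x.b * y.b := rfl
@[simp] theorem mul_c (x y : Exponent) : (x * y).c = x.c * y.b + x.v * y.c := rfl
@[simp] theorem mul_v (x y : Exponent) : (x * y).v = x.v * y.v := rfl

instance : Ring Exponent where
  add_assoc x y z := by ext <;> simp [add_assoc]
  zero_add x := by ext <;> simp
  add_zero x := by ext <;> simp
  add_comm x y := by ext <;> simp [add_comm]
  neg_add_cancel x := by ext <;> simp
  mul_assoc x y z := by ext <;> simp <;> ring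
  one_mul x := by ext <;> simp
  mul_one x := by ext <;> simp
  zero_mul x := by ext <;> simp
  mul_zero x := by ext <;> simp
  left_distrib x y z := by ext <;> simp <;> ring
  right_distrib x y z := by ext <;> simp <;> ring
  nsmul := nsmulRec
  zsmul := zsmulRec

end Exponent

/-- `g ^ μ = |g| ^ (b + √-1 c) * (g / |g|) ^ v` for `μ = (b + √-1 c, v)`; only used for `g ≠ 0`. -/
def cpw (g : ℂ) (μ : Exponent) : ℂ :=
  (‖g‖ : ℂ) ^ ((μ.b : ℂ) + (μ.c : ℂ) * Complex.I) * (g / (‖g‖ : ℂ)) ^ μ.v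

theorem cpw_ne_zero {g : ℂ} (hg : g ≠ 0) (μ : Exponent) : cpw g μ ≠ 0 := by
  have h : (‖g‖ : ℂ) ≠ 0 := by simpa using hg
  refine mul_ne_zero ?_ (zpow_ne_zero _ (div_ne_zero hg h))
  simp [Complex.cpow_eq_zero_iff, hg]

theorem cpw_mul (g h : ℂ) (μ : Exponent) : cpw (g * h) μ = cpw g μ * cpw h μ := by
  unfold cpw
  rw [norm_mul, Complex.ofReal_mul, Complex.mul_cpow_ofReal_nonneg (norm_nonneg _) (norm_nonneg _),
    mul_div_mul_comm, mul_zpow]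
  ring

theorem cpw_one (μ : Exponent) : cpw 1 μ = 1 := by
  simp [cpw]

/-- The smooth endomorphism `g ↦ g ^ μ` of `ℂ*`. -/
def powHom (μ : Exponent) : ℂˣ →* ℂˣ where
  toFun g := Units.mk0 (cpw g μ) (cpw_ne_zero g.ne_zero μ)
  map_one' := Units.ext (by simp [cpw_one])
  map_mul' g h := Units.ext (by simp [cpw_mul])

/-- The torus `(ℂ*)ⁿ`, realised as the unit group of the ring `ℂⁿ` (with pointwise product);
Mathlib gives it the structure of a Lie group, as an open subset of `ℂⁿ`. -/
abbrev Torus (n : ℕ) := (Fin n → ℂ)ˣ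

/-- The `k`-th coordinate of an element of `(ℂ*)ⁿ`. -/
def Torus.coord {n : ℕ} (k : Fin n) : Torus n →* ℂˣ :=
  Units.map (Pi.evalMonoidHom (fun _ => ℂ) k)

/-- The character `χ^α(g₁, …, gₙ) = ∏ₖ gₖ ^ αᵏ` of `(ℂ*)ⁿ`. -/
def chi {n : ℕ} (α : Fin n → Exponent) : Torus n →* ℂˣ :=
  ∏ k, (powHom (α k)).comp (Torus.coord k)

/-- The homomorphism `λ_β(g) = (g ^ β¹, …, g ^ βⁿ)` from `ℂ*` to `(ℂ*)ⁿ`. -/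
def lamHom {n : ℕ} (β : Fin n → Exponent) : ℂˣ →* Torus n :=
  (MulEquiv.piUnits (M := fun _ : Fin n => ℂ)).symm.toMonoidHom.comp
    (MonoidHom.pi fun k => powHom (β k))

/-- `⟨α, β⟩ = ∑ₖ αᵏ βᵏ ∈ 𝓡`. -/
def pairing {n : ℕ} (α β : Fin n → Exponent) : Exponent := ∑ k, α k * β k

/-- The cone spanned by the vectors `bᵢ`, `i ∈ I`. -/
def cone {n m : ℕ} (b : Fin m → Fin n → ℝ) (I : Finset (Fin m)) : Set (Fin n → ℝ) :=
  {x | ∃ r : Fin m → ℝ, (∀ i, 0 ≤ r i) ∧ x = ∑ i ∈ I, r i • b i}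

/-- A (simplicial) topological fan `(Σ, β)` of dimension `n` with vertex set `Fin m`:
`Σ` is an abstract simplicial complex of dimension `n - 1` (the empty simplex included) whose
vertices are all the elements of `Fin m`, and `β i = (bᵢ + √-1 cᵢ, vᵢ) ∈ ℂⁿ × ℤⁿ = 𝓡ⁿ`. -/
structure TopologicalFan (n m : ℕ) where
  faces : Set (Finset (Fin m))
  β : Fin m → Fin n → Exponent
  empty_mem : ∅ ∈ faces
  down_closed : ∀ I ∈ faces, ∀ J ⊆ I, J ∈ faces
  singleton_mem : ∀ i, {i} ∈ faces
  card_le : ∀ I ∈ faces, I.card ≤ n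
  exists_card_eq : ∃ I ∈ faces, I.card = n
  b_indep : ∀ I ∈ faces, LinearIndependent ℝ (fun (i : I) (k : Fin n) => (β i k).b)
  cone_inter : ∀ I ∈ faces, ∀ J ∈ faces,
    cone (fun i k => (β i k).b) I ∩ cone (fun i k => (β i k).b) J =
      cone (fun i k => (β i k).b) (I ∩ J)
  v_primitive : ∀ i, ∀ d : ℤ, (∀ k, d ∣ (β i k).v) → IsUnit d
  v_indep : ∀ I ∈ faces, LinearIndependent ℝ (fun (i : I) (k : Fin n) => ((β i k).v : ℝ))

namespace TopologicalFan

variable {n m : ℕ} (Δ : TopologicalFan n m)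

/-- The cones of the fan cover `ℝⁿ`. -/
def IsComplete : Prop :=
  ⋃ I ∈ Δ.faces, cone (fun i k => (Δ.β i k).b) I = Set.univ

/-- For every simplex `I`, the `vᵢ`, `i ∈ I`, form a part of a `ℤ`-basis of `ℤⁿ`. -/
def IsNonsingular : Prop :=
  ∀ I ∈ Δ.faces, ∃ (B : Module.Basis (Fin n) ℤ (Fin n → ℤ)) (f : I ↪ Fin n),
    ∀ (i : I) (k : Fin n), B (f i) k = (Δ.β i k).v

/-- `U(I) = {z ∈ ℂᵐ | zᵢ ≠ 0 for all i ∉ I}`. -/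
def coordOpen (I : Finset (Fin m)) : Set (Fin m → ℂ) := {z | ∀ i, i ∉ I → z i ≠ 0}

/-- `U(Σ) = ⋃_{I ∈ Σ} U(I)`. -/
def U : Set (Fin m → ℂ) := ⋃ I ∈ Δ.faces, coordOpen I

/-- The natural action of `(ℂ*)ᵐ` on `U(Σ)`, by coordinatewise product. -/
instance : MulAction (Torus m) Δ.U where
  smul h z := ⟨(h : Fin m → ℂ) * (z : Fin m → ℂ), by
    obtain ⟨z, hz⟩ := z
    simp only [U, Set.mem_iUnion] at hz ⊢
    obtain ⟨I, hI, hz⟩ := hz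
    exact ⟨I, hI, fun i hi => mul_ne_zero (Torus.coord i h).ne_zero (hz i hi)⟩⟩
  one_smul z := Subtype.ext (one_mul _)
  mul_smul g h z := Subtype.ext (mul_assoc _ _ _)

/-- `λ(h₁, …, hₘ) = ∏ₖ λ_{βₖ}(hₖ)`, a homomorphism from `(ℂ*)ᵐ` to `(ℂ*)ⁿ`. -/
def lam : Torus m →* Torus n := ∏ k, (lamHom (Δ.β k)).comp (Torus.coord k)

/-- `X(Δ) = U(Σ) / Ker λ`. -/
def X : Type := Quotient (MulAction.orbitRel Δ.lam.ker Δ.U)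

/-- The quotient map `U(Σ) → X(Δ)`. -/
def proj (z : Δ.U) : Δ.X := Quotient.mk _ z

/-- The quotient topology. -/
instance : TopologicalSpace Δ.X :=
  inferInstanceAs (TopologicalSpace (Quotient (MulAction.orbitRel Δ.lam.ker Δ.U)))

/-- The set `Σ⁽ⁿ⁾` of `(n - 1)`-simplices. -/
def Facet : Type := {I : Finset (Fin m) // I ∈ Δ.faces ∧ I.card = n}

variable {Δ}

/-- The elements of a facet `I` in increasing order. Through this enumeration, families indexed
by `I` are indexed by `Fin n`; in particular `ℂ^I` is identified with `ℂⁿ`. -/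
def Facet.enum (I : Δ.Facet) : Fin n ↪o Fin m := I.1.orderEmbOfFin I.2.2

/-- `{αᵢ}` is dual to `{βᵢ}`, `i ∈ I`: `⟨αᵢ, βⱼ⟩ = δᵢⱼ 𝟏`. -/
def Facet.IsDual (I : Δ.Facet) (α : Fin n → Fin n → Exponent) : Prop :=
  ∀ i j, pairing (α i) (Δ.β (I.enum j)) = if i = j then 1 else 0

/-- The subset `U(I) / Ker λ` of `X(Δ)`. -/
def Facet.domain (I : Δ.Facet) : Set Δ.X := Δ.proj '' {z | (z : Fin m → ℂ) ∈ coordOpen I.1}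

/-- The map `z ↦ (zᵢ ∏_{k ∉ I} zₖ ^ ⟨αᵢ, βₖ⟩)_{i ∈ I}` from `U(I)` to `ℂ^I`. -/
def Facet.chartMap (I : Δ.Facet) (α : Fin n → Fin n → Exponent) (z : Fin m → ℂ) : Fin n → ℂ :=
  fun i => z (I.enum i) * ∏ k ∈ I.1ᶜ, cpw (z k) (pairing (α i) (Δ.β k))

end TopologicalFan

/-- `V ⊆ X` is equivariantly diffeomorphic to a direct sum of complex one-dimensional smooth
representation spaces of `(ℂ*)ⁿ`. Smoothness is over `ℝ`; a one-dimensional representation is a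
smooth homomorphism `(ℂ*)ⁿ → GL(1, ℂ) = ℂ*`. -/
def IsRepresentationDomain (n : ℕ) {X : Type*} [TopologicalSpace X] [ChartedSpace (Fin n → ℂ) X]
    [MulAction (Torus n) X] (V : Set X) : Prop :=
  ∃ (ρ : Fin n → Torus n →* ℂˣ) (e : OpenPartialHomeomorph X (Fin n → ℂ)),
    (∀ i, ContMDiff 𝓘(ℝ, Fin n → ℂ) 𝓘(ℝ, ℂ) ∞ (ρ i)) ∧
    e.source = V ∧ e.target = Set.univ ∧
    ContMDiffOn 𝓘(ℝ, Fin n → ℂ) 𝓘(ℝ, Fin n → ℂ) ∞ e V ∧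
    ContMDiff 𝓘(ℝ, Fin n → ℂ) 𝓘(ℝ, Fin n → ℂ) ∞ e.symm ∧
    ∀ (g : Torus n), ∀ x ∈ V, ∀ i, e (g • x) i = ρ i g * e x i

/-- `X` is a topological toric manifold of real dimension `2n`: a closed (compact, boundaryless)
smooth manifold with an effective smooth action of `(ℂ*)ⁿ` having an open dense orbit, covered by
finitely many invariant open subsets, each equivariantly diffeomorphic to a direct sum of complex
one-dimensional smooth representation spaces. -/
structure IsTopologicalToricManifold (n : ℕ) (X : Type*) [TopologicalSpace X]
    [ChartedSpace (Fin n → ℂ) X] [MulAction (Torus n) X] : Prop where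
  t2 : T2Space X
  secondCountable : SecondCountableTopology X
  compact : CompactSpace X
  smooth_manifold : IsManifold 𝓘(ℝ, Fin n → ℂ) ∞ X
  smooth_action : ContMDiff (𝓘(ℝ, Fin n → ℂ).prod 𝓘(ℝ, Fin n → ℂ)) 𝓘(ℝ, Fin n → ℂ) ∞
    (fun p : Torus n × X => p.1 • p.2)
  effective : FaithfulSMul (Torus n) X
  open_dense_orbit : ∃ x : X, IsOpen (MulAction.orbit (Torus n) x) ∧
    Dense (MulAction.orbit (Torus n) x)
  cover : ∃ S : Set (Set X), S.Finite ∧ ⋃₀ S = Set.univ ∧ ∀ V ∈ S, IsOpen V ∧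
    (∀ (g : Torus n), ∀ x ∈ V, g • x ∈ V) ∧ IsRepresentationDomain n V

end TopToric

end

noncomputable section

namespace TopToric

namespace Exponent

/-- The entry `b` as an additive homomorphism. -/
def bHom : Exponent →+ ℝ := ⟨⟨Exponent.b, rfl⟩, fun _ _ => rfl⟩

/-- The entry `c` as an additive homomorphism. -/
def cHom : Exponent →+ ℝ := ⟨⟨Exponent.c, rfl⟩, fun _ _ => rfl⟩

/-- The entry `v` as an additive homomorphism. -/
def vHom : Exponent →+ ℤ := ⟨⟨Exponent.v, rfl⟩, fun _ _ => rfl⟩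

theorem sum_b {ι : Type*} (s : Finset ι) (f : ι → Exponent) : (∑ i ∈ s, f i).b = ∑ i ∈ s, (f i).b :=
  map_sum bHom f s

theorem sum_c {ι : Type*} (s : Finset ι) (f : ι → Exponent) : (∑ i ∈ s, f i).c = ∑ i ∈ s, (f i).c :=
  map_sum cHom f s

theorem sum_v {ι : Type*} (s : Finset ι) (f : ι → Exponent) : (∑ i ∈ s, f i).v = ∑ i ∈ s, (f i).v :=
  map_sum vHom f s

end Exponent

theorem norm_cpw {g : ℂ} (hg : g ≠ 0) (μ : Exponent) : ‖cpw g μ‖ = ‖g‖ ^ μ.b := by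
  have h : 0 < ‖g‖ := norm_pos_iff.2 hg
  rw [cpw, norm_mul, Complex.norm_cpow_eq_rpow_re_of_pos h, norm_zpow, norm_div, Complex.norm_real,
    norm_norm, div_self h.ne', one_zpow, mul_one]
  simp

theorem cpw_zero (g : ℂ) : cpw g 0 = 1 := by simp [cpw]

theorem cpw_one_right {g : ℂ} (hg : g ≠ 0) : cpw g 1 = g := by
  have h : (‖g‖ : ℂ) ≠ 0 := by simpa using hg
  simp [cpw, mul_div_cancel₀ _ h]

theorem cpw_add {g : ℂ} (hg : g ≠ 0) (μ ν : Exponent) : cpw g (μ + ν) = cpw g μ * cpw g ν := by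
  have h : (‖g‖ : ℂ) ≠ 0 := by simpa using hg
  simp only [cpw, Exponent.add_b, Exponent.add_c, Exponent.add_v]
  rw [zpow_add₀ (div_ne_zero hg h), Complex.ofReal_add, Complex.ofReal_add,
    show ((μ.b : ℂ) + ν.b + (μ.c + ν.c) * Complex.I)
      = (μ.b + μ.c * Complex.I) + (ν.b + ν.c * Complex.I) by ring, Complex.cpow_add _ _ h]
  ring

theorem cpw_eq_exp {g : ℂ} (hg : g ≠ 0) (μ : Exponent) :
    cpw g μ = Complex.exp (Real.log ‖g‖ * (μ.b + μ.c * Complex.I)) * (g / (‖g‖ : ℂ)) ^ μ.v := by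
  have h : (‖g‖ : ℂ) ≠ 0 := by simpa using hg
  rw [cpw, Complex.cpow_def_of_ne_zero h, Complex.ofReal_log (norm_nonneg _)]

theorem cpw_cpw {g : ℂ} (hg : g ≠ 0) (μ ν : Exponent) : cpw (cpw g μ) ν = cpw g (ν * μ) := by
  have h : 0 < ‖g‖ := norm_pos_iff.2 hg
  have h' : (‖g‖ : ℂ) ≠ 0 := by simpa using hg
  have hlog : Real.log ‖cpw g μ‖ = μ.b * Real.log ‖g‖ := by
    rw [norm_cpw hg, Real.log_rpow h]
  have hnorm : (‖cpw g μ‖ : ℂ) = Complex.exp (μ.b * Real.log ‖g‖) := by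
    rw [norm_cpw hg, Real.rpow_def_of_pos h, Complex.ofReal_exp]
    push_cast
    rw [mul_comm]
  have hdir : cpw g μ / (‖cpw g μ‖ : ℂ) =
      Complex.exp (Real.log ‖g‖ * (μ.c * Complex.I)) * (g / (‖g‖ : ℂ)) ^ μ.v := by
    rw [hnorm, cpw_eq_exp hg, div_eq_iff (Complex.exp_ne_zero _), mul_right_comm, ← Complex.exp_add]
    congr 2
    ring
  rw [cpw_eq_exp (cpw_ne_zero hg μ), hdir, hlog, cpw_eq_exp hg, mul_zpow, ← mul_assoc,
    ← Complex.exp_int_mul, ← Complex.exp_add, ← zpow_mul, Exponent.mul_v, mul_comm μ.v]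
  congr 2
  simp only [Exponent.mul_b, Exponent.mul_c]
  push_cast
  ring

theorem contDiffAt_cpw {g : ℂ} (hg : g ≠ 0) (μ : Exponent) :
    ContDiffAt ℝ ∞ (fun z => cpw z μ) g := by
  have hev : (fun z => cpw z μ) =ᶠ[nhds g] fun z =>
      Complex.exp (Real.log ‖z‖ * (μ.b + μ.c * Complex.I)) * (z / (‖z‖ : ℂ)) ^ μ.v := by
    filter_upwards [isOpen_ne.mem_nhds hg] with z hz using cpw_eq_exp hz μ
  refine ContDiffAt.congr_of_eventuallyEq ?_ hev
  have hn : ContDiffAt ℝ ∞ (fun z : ℂ => ‖z‖) g := contDiffAt_norm ℝ hg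
  have hn' : ContDiffAt ℝ ∞ (fun z : ℂ => (‖z‖ : ℂ)) g :=
    Complex.ofRealCLM.contDiff.contDiffAt.comp g hn
  have hl : ContDiffAt ℝ ∞ (fun z : ℂ => (Real.log ‖z‖ : ℂ)) g :=
    Complex.ofRealCLM.contDiff.contDiffAt.comp g (hn.log (norm_ne_zero_iff.2 hg))
  have h' : (‖g‖ : ℂ) ≠ 0 := by simpa using hg
  have hd : ContDiffAt ℝ ∞ (fun z : ℂ => z / (‖z‖ : ℂ)) g := by
    simp only [div_eq_mul_inv]
    exact contDiffAt_id.mul (hn'.inv h')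
  refine (hl.mul contDiffAt_const).cexp.mul ?_
  cases μ.v with
  | ofNat k => simpa using hd.pow k
  | negSucc k =>
    simp only [zpow_negSucc]
    exact (hd.pow (k + 1)).inv (pow_ne_zero _ (div_ne_zero hg h'))

@[simp] theorem coe_powHom (μ : Exponent) (g : ℂˣ) : (powHom μ g : ℂ) = cpw g μ := rfl

theorem powHom_add (μ ν : Exponent) : powHom (μ + ν) = powHom μ * powHom ν := by
  ext g
  simp [cpw_add g.ne_zero]

theorem powHom_zero : powHom 0 = 1 := by
  ext g
  simp [cpw_zero]

theorem powHom_one : powHom 1 = MonoidHom.id ℂˣ := by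
  ext g
  simp [cpw_one_right g.ne_zero]

theorem powHom_powHom (μ ν : Exponent) (g : ℂˣ) : powHom ν (powHom μ g) = powHom (ν * μ) g := by
  ext
  simp [cpw_cpw g.ne_zero]

theorem powHom_sum {ι : Type*} (s : Finset ι) (f : ι → Exponent) :
    powHom (∑ i ∈ s, f i) = ∏ i ∈ s, powHom (f i) := by
  classical
  induction s using Finset.induction_on with
  | empty => simp [powHom_zero]
  | insert a s ha ih => rw [Finset.sum_insert ha, Finset.prod_insert ha, powHom_add, ih]

namespace Torus

variable {n : ℕ}

@[simp] theorem coe_coord (k : Fin n) (g : Torus n) : (coord k g : ℂ) = (g : Fin n → ℂ) k := rfl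

theorem ext_coord {g h : Torus n} (H : ∀ k, coord k g = coord k h) : g = h :=
  Units.ext (funext fun k => congrArg Units.val (H k))

/-- The element of `(ℂ*)ⁿ` with given coordinates. -/
def mk (f : Fin n → ℂˣ) : Torus n := (MulEquiv.piUnits (M := fun _ : Fin n => ℂ)).symm f

@[simp] theorem coord_mk (f : Fin n → ℂˣ) (k : Fin n) : coord k (mk f) = f k := Units.ext rfl

end Torus

theorem chi_apply {n : ℕ} (α : Fin n → Exponent) (g : Torus n) :
    chi α g = ∏ k, powHom (α k) (Torus.coord k g) := by
  simp [chi, MonoidHom.finsetProd_apply]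

@[simp] theorem coord_lamHom {n : ℕ} (β : Fin n → Exponent) (g : ℂˣ) (k : Fin n) :
    Torus.coord k (lamHom β g) = powHom (β k) g := Units.ext rfl

theorem chi_lamHom {n : ℕ} (α β : Fin n → Exponent) (g : ℂˣ) :
    chi α (lamHom β g) = powHom (pairing α β) g := by
  simp [chi_apply, pairing, powHom_sum, powHom_powHom, MonoidHom.finsetProd_apply]

namespace TopologicalFan

variable {n m : ℕ} (Δ : TopologicalFan n m)

theorem lam_apply (h : Torus m) : Δ.lam h = ∏ k, lamHom (Δ.β k) (Torus.coord k h) := by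
  simp [lam, MonoidHom.finsetProd_apply]

theorem chi_lam (α : Fin n → Exponent) (h : Torus m) :
    chi α (Δ.lam h) = ∏ k, powHom (pairing α (Δ.β k)) (Torus.coord k h) := by
  simp [lam_apply, map_prod, chi_lamHom]

end TopologicalFan

namespace Exponent

variable {ι : Type*}

theorem matrix_ext {M N : Matrix ι ι Exponent} (hb : M.map b = N.map b) (hc : M.map c = N.map c)
    (hv : M.map v = N.map v) : M = N := by
  ext i j
  · exact congrFun (congrFun hb i) j
  · exact congrFun (congrFun hc i) j
  · exact congrFun (congrFun hv i) j

theorem map_b_one [DecidableEq ι] : (1 : Matrix ι ι Exponent).map b = 1 := Matrix.map_one _ rfl rfl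

theorem map_v_one [DecidableEq ι] : (1 : Matrix ι ι Exponent).map v = 1 := Matrix.map_one _ rfl rfl

theorem map_c_one [DecidableEq ι] : (1 : Matrix ι ι Exponent).map c = 0 := by
  ext i j
  by_cases h : i = j <;> simp [h]

variable [Fintype ι]

theorem map_b_mul (M N : Matrix ι ι Exponent) : (M * N).map b = M.map b * N.map b := by
  ext i j
  simp [Matrix.mul_apply, sum_b]

theorem map_v_mul (M N : Matrix ι ι Exponent) : (M * N).map v = M.map v * N.map v := by
  ext i j
  simp [Matrix.mul_apply, sum_v]

theorem map_c_mul (M N : Matrix ι ι Exponent) : (M * N).map c =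
    M.map c * N.map b + ((M.map v).map (Int.castRingHom ℝ)) * N.map c := by
  ext i j
  simp [Matrix.mul_apply, sum_c, Finset.sum_add_distrib]

variable [DecidableEq ι]

/-- A matrix over `𝓡` is invertible as soon as its components over `ℝ` and over `ℤ` are. -/
theorem isUnit_matrix {M : Matrix ι ι Exponent} (hb : IsUnit (M.map b)) (hv : IsUnit (M.map v)) :
    IsUnit M := by
  obtain ⟨P, hP⟩ := hb
  obtain ⟨Q, hQ⟩ := hv
  let B : Matrix ι ι ℝ := ↑P⁻¹
  let V : Matrix ι ι ℤ := ↑Q⁻¹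
  have hB1 : B * M.map b = 1 := by rw [← hP]; exact P.inv_mul
  have hB2 : M.map b * B = 1 := by rw [← hP]; exact P.mul_inv
  have hV1 : V * M.map v = 1 := by rw [← hQ]; exact Q.inv_mul
  have hV2 : M.map v * V = 1 := by rw [← hQ]; exact Q.mul_inv
  have hV2' : (M.map v).map (Int.castRingHom ℝ) * V.map (Int.castRingHom ℝ) = 1 := by
    rw [← Matrix.map_mul, hV2, Matrix.map_one _ (map_zero _) (map_one _)]
  let C : Matrix ι ι ℝ := -(V.map (Int.castRingHom ℝ) * M.map c * B)
  let N : Matrix ι ι Exponent := Matrix.of fun i j => ⟨B i j, C i j, V i j⟩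
  have hNb : N.map b = B := rfl
  have hNc : N.map c = C := rfl
  have hNv : N.map v = V := rfl
  refine ⟨⟨M, N, matrix_ext ?_ ?_ ?_, matrix_ext ?_ ?_ ?_⟩, rfl⟩
  · rw [map_b_mul, hNb, hB2, map_b_one]
  · rw [map_c_mul, hNb, hNc, map_c_one, Matrix.mul_neg, ← Matrix.mul_assoc, ← Matrix.mul_assoc, hV2',
      Matrix.one_mul, add_neg_cancel]
  · rw [map_v_mul, hNv, hV2, map_v_one]
  · rw [map_b_mul, hNb, hB1, map_b_one]
  · rw [map_c_mul, hNv, hNc, map_c_one, Matrix.neg_mul, Matrix.mul_assoc, hB1, Matrix.mul_one,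
      neg_add_cancel]
  · rw [map_v_mul, hNv, hV1, map_v_one]

end Exponent

namespace TopologicalFan

variable {n m : ℕ} {Δ : TopologicalFan n m}

namespace Facet

variable (I : Δ.Facet)

theorem enum_mem (i : Fin n) : I.enum i ∈ I.1 := Finset.orderEmbOfFin_mem _ _ _

theorem mem_iff_exists_enum {k : Fin m} : k ∈ I.1 ↔ ∃ i, I.enum i = k := by
  have h := Finset.range_orderEmbOfFin I.1 I.2.2
  rw [← Finset.mem_coe, ← h]
  rfl

theorem image_enum : Finset.univ.image I.enum = I.1 := by
  ext k
  simp [mem_iff_exists_enum]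

@[to_additive]
theorem prod_enum {M : Type*} [CommMonoid M] (f : Fin m → M) :
    ∏ i, f (I.enum i) = ∏ k ∈ I.1, f k := by
  rw [← I.image_enum, Finset.prod_image fun _ _ _ _ h => I.enum.injective h]

/-- The square matrix over `𝓡` whose columns are the `βᵢ`, `i ∈ I`. -/
def betaMatrix : Matrix (Fin n) (Fin n) Exponent := Matrix.of fun k j => Δ.β (I.enum j) k

theorem isDual_iff (α : Fin n → Fin n → Exponent) :
    I.IsDual α ↔ Matrix.of α * I.betaMatrix = 1 := by
  rw [← Matrix.ext_iff]
  rfl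

theorem isUnit_betaMatrix (hns : Δ.IsNonsingular) : IsUnit I.betaMatrix := by
  have hinj : Function.Injective fun j : Fin n => (⟨I.enum j, I.enum_mem j⟩ : I.1) := fun i j h =>
    I.enum.injective (congrArg Subtype.val h)
  apply Exponent.isUnit_matrix
  · rw [← Matrix.isUnit_transpose, ← Matrix.linearIndependent_rows_iff_isUnit]
    exact (Δ.b_indep I.1 I.2.1).comp _ hinj
  · obtain ⟨B, f, hf⟩ := hns I.1 I.2.1
    let σ : Fin n ≃ Fin n := Equiv.ofBijective (fun j => f ⟨I.enum j, I.enum_mem j⟩)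
      (Finite.injective_iff_bijective.1 (f.injective.comp hinj))
    have h : I.betaMatrix.map Exponent.v =
        (Pi.basisFun ℤ (Fin n)).toMatrix (B.reindex σ.symm) := by
      ext k j
      simp only [Module.Basis.toMatrix_apply, Pi.basisFun_repr, Module.Basis.reindex_apply,
        Equiv.symm_symm]
      exact (hf ⟨I.enum j, I.enum_mem j⟩ k).symm
    rw [h]
    have := Module.Basis.invertibleToMatrix (Pi.basisFun ℤ (Fin n)) (B.reindex σ.symm)
    exact isUnit_of_invertible _

theorem existsUnique_isDual (hns : Δ.IsNonsingular) :
    ∃! α : Fin n → Fin n → Exponent, I.IsDual α := by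
  obtain ⟨u, hu⟩ := I.isUnit_betaMatrix hns
  refine ⟨fun i j => (↑u⁻¹ : Matrix (Fin n) (Fin n) Exponent) i j, ?_, fun α h => ?_⟩
  · refine (I.isDual_iff _).2 ?_
    rw [← hu]
    exact u.inv_mul
  · replace h := (I.isDual_iff α).1 h
    rw [← hu] at h
    exact (Units.eq_inv_of_mul_eq_one_right h : Matrix.of α = _)

variable {I} {α : Fin n → Fin n → Exponent}

theorem IsDual.betaMatrix_mul (h : I.IsDual α) (hns : Δ.IsNonsingular) :
    I.betaMatrix * Matrix.of α = 1 := by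
  obtain ⟨u, hu⟩ := I.isUnit_betaMatrix hns
  rw [isDual_iff, ← hu] at h
  have e : Matrix.of α = ↑u⁻¹ := Units.eq_inv_of_mul_eq_one_right h
  rw [← hu, e]
  exact u.mul_inv

/-- The inverse of the isomorphism `(ℂ*)ⁿ → (ℂ*)ⁿ` given by the characters dual to `βᵢ`, `i ∈ I`. -/
theorem IsDual.prod_lamHom_chi (h : I.IsDual α) (hns : Δ.IsNonsingular) (g : Torus n) :
    ∏ j, lamHom (Δ.β (I.enum j)) (chi (α j) g) = g := by
  refine Torus.ext_coord fun k => ?_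
  have key : ∀ l, ∑ j, Δ.β (I.enum j) k * α j l = if k = l then 1 else 0 := fun l => by
    have := congrFun (congrFun (h.betaMatrix_mul hns) k) l
    rwa [Matrix.mul_apply, Matrix.one_apply] at this
  simp only [map_prod, coord_lamHom, chi_apply, powHom_powHom]
  rw [Finset.prod_comm]
  have : ∀ l, ∏ j, powHom (Δ.β (I.enum j) k * α j l) (Torus.coord l g) =
      if k = l then Torus.coord l g else 1 := fun l => by
    rw [← MonoidHom.finsetProd_apply, ← powHom_sum, key]
    split_ifs <;> simp [powHom_one, powHom_zero]
  simp [this]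

theorem IsDual.eq_one (h : I.IsDual α) (hns : Δ.IsNonsingular) {g : Torus n}
    (hg : ∀ i, chi (α i) g = 1) : g = 1 := by
  rw [← h.prod_lamHom_chi hns g]
  simp [hg]

theorem lam_surjective (I : Δ.Facet) (hns : Δ.IsNonsingular) : Function.Surjective Δ.lam := by
  intro g
  obtain ⟨α, h, -⟩ := I.existsUnique_isDual hns
  refine ⟨Torus.mk (Function.extend I.enum (fun i => chi (α i) g) 1), ?_⟩
  rw [lam_apply, ← Finset.prod_subset (Finset.subset_univ I.1), ← I.prod_enum]
  · simpa [I.enum.injective.extend_apply] using h.prod_lamHom_chi hns g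
  · intro k _ hk
    rw [Torus.coord_mk, Function.extend_apply' _ _ _ (by rwa [← I.mem_iff_exists_enum])]
    simp

end Facet

theorem nonempty_facet (Δ : TopologicalFan n m) : Nonempty Δ.Facet :=
  let ⟨I, hI, h⟩ := Δ.exists_card_eq
  ⟨⟨I, hI, h⟩⟩

instance : Finite Δ.Facet := inferInstanceAs (Finite {I : Finset (Fin m) // I ∈ Δ.faces ∧ I.card = n})

end TopologicalFan

namespace TopologicalFan

variable {n m : ℕ} {Δ : TopologicalFan n m}

/-- The real vectors `bᵢ` spanning the cones of the fan. -/
def ray (Δ : TopologicalFan n m) (i : Fin m) : Fin n → ℝ := fun k => (Δ.β i k).b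

theorem pairing_b (α : Fin n → Exponent) (i : Fin m) :
    (pairing α (Δ.β i)).b = ∑ k, (α k).b * Δ.ray i k := by
  simp [pairing, Exponent.sum_b, ray]

/-- Expansion of a vector in the basis `bᵢ`, `i ∈ I`. -/
theorem Facet.IsDual.sum_smul_ray {I : Δ.Facet} {α : Fin n → Fin n → Exponent} (h : I.IsDual α)
    (hns : Δ.IsNonsingular) (x : Fin n → ℝ) :
    ∑ j, (∑ k, (α j k).b * x k) • Δ.ray (I.enum j) = x := by
  ext l
  have key : ∀ k, ∑ j, Δ.ray (I.enum j) l * (α j k).b = if l = k then 1 else 0 := fun k => by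
    have := congrArg Exponent.b (congrFun (congrFun (h.betaMatrix_mul hns) l) k)
    rw [Matrix.mul_apply, Exponent.sum_b, Matrix.one_apply] at this
    rw [show (if l = k then (1 : ℝ) else 0) = (if l = k then (1 : Exponent) else 0).b by
      split_ifs <;> rfl]
    exact this
  simp only [Finset.sum_apply, Pi.smul_apply, smul_eq_mul, Finset.sum_mul]
  rw [Finset.sum_comm]
  simp only [mul_right_comm _ (x _), mul_comm _ (Δ.ray _ l)]
  simp [← Finset.sum_mul, key]

/-- The cone of a facet is cut out by the dual family. -/
theorem Facet.IsDual.mem_cone_iff {I : Δ.Facet} {α : Fin n → Fin n → Exponent} (h : I.IsDual α)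
    (hns : Δ.IsNonsingular) {x : Fin n → ℝ} :
    x ∈ cone Δ.ray I.1 ↔ ∀ i, 0 ≤ ∑ k, (α i k).b * x k := by
  constructor
  · rintro ⟨r, hr, rfl⟩ i
    have : ∑ k, (α i k).b * (∑ j ∈ I.1, r j • Δ.ray j) k = r (I.enum i) := by
      rw [← I.sum_enum fun j => r j • Δ.ray j]
      have hd : ∀ j, ∑ k, (α i k).b * Δ.ray (I.enum j) k = if i = j then 1 else 0 := fun j => by
        rw [← pairing_b, h i j]
        split_ifs <;> rfl
      simp only [Finset.sum_apply, Pi.smul_apply, smul_eq_mul, Finset.mul_sum]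
      rw [Finset.sum_comm]
      simp only [mul_left_comm _ (r _), ← Finset.mul_sum, hd]
      simp
    rw [this]
    exact hr _
  · intro hx
    refine ⟨Function.extend I.enum (fun i => ∑ k, (α i k).b * x k) 0, fun j => ?_, ?_⟩
    · by_cases hj : ∃ i, I.enum i = j
      · obtain ⟨i, rfl⟩ := hj
        rw [I.enum.injective.extend_apply]
        exact hx i
      · rw [Function.extend_apply' _ _ _ hj]
        rfl
    · rw [← I.sum_enum fun j => _ • Δ.ray j]
      simp only [I.enum.injective.extend_apply]
      exact (h.sum_smul_ray hns x).symm

theorem Facet.isClosed_cone (I : Δ.Facet) (hns : Δ.IsNonsingular) : IsClosed (cone Δ.ray I.1) := by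
  obtain ⟨α, h, -⟩ := I.existsUnique_isDual hns
  have : cone Δ.ray I.1 = ⋂ i, {x | 0 ≤ ∑ k, (α i k).b * x k} := by
    ext x
    simp [h.mem_cone_iff hns]
  rw [this]
  exact isClosed_iInter fun i => isClosed_le continuous_const (by fun_prop)

theorem cone_subset_span (b : Fin m → Fin n → ℝ) (I : Finset (Fin m)) :
    cone b I ⊆ Submodule.span ℝ (I.image b : Set (Fin n → ℝ)) := by
  rintro x ⟨r, -, rfl⟩
  exact Submodule.sum_mem _ fun i hi => Submodule.smul_mem _ _
    (Submodule.subset_span (Finset.mem_coe.2 (Finset.mem_image_of_mem b hi)))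

open MeasureTheory in
theorem volume_cone_of_card_lt (b : Fin m → Fin n → ℝ) {I : Finset (Fin m)} (hI : I.card < n) :
    volume (cone b I) = 0 := by
  refine measure_mono_null (cone_subset_span b I) (Measure.addHaar_submodule _ _ fun htop => ?_)
  have h1 := finrank_span_finset_le_card (R := ℝ) (I.image b)
  rw [Set.finrank, htop, finrank_top, Module.finrank_fin_fun] at h1
  exact absurd (h1.trans Finset.card_image_le) (not_le.2 hI)

open MeasureTheory in
/-- In a complete fan the top-dimensional cones cover the whole space. -/
theorem exists_facet_mem_cone (hc : Δ.IsComplete) (hns : Δ.IsNonsingular) (x : Fin n → ℝ) :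
    ∃ I : Δ.Facet, x ∈ cone Δ.ray I.1 := by
  by_contra! hx
  let T : Set (Fin n → ℝ) := ⋃ I : Δ.Facet, cone Δ.ray I.1
  have hT : IsOpen Tᶜ := (isClosed_iUnion_of_finite fun I : Δ.Facet => I.isClosed_cone hns).isOpen_compl
  have hne : (Tᶜ).Nonempty := ⟨x, by simpa [T] using hx⟩
  refine (hT.measure_pos volume hne).ne' (measure_mono_null (t :=
    ⋃ I ∈ {I : Finset (Fin m) | I.card < n}, cone Δ.ray I) ?_ ?_)
  · intro y hy
    have hy' : y ∈ ⋃ I ∈ Δ.faces, cone Δ.ray I := hc.symm ▸ Set.mem_univ y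
    simp only [Set.mem_iUnion] at hy' ⊢
    obtain ⟨I, hI, hyI⟩ := hy'
    refine ⟨I, lt_of_le_of_ne (Δ.card_le I hI) fun hcard => hy ?_, hyI⟩
    exact Set.mem_iUnion.2 ⟨⟨I, hI, hcard⟩, hyI⟩
  · exact (measure_biUnion_null_iff (Set.to_countable _)).2 fun I hI => volume_cone_of_card_lt _ hI

/-- The coefficients on a simplex of a linear combination of the `bᵢ` are determined by its value. -/
theorem coeff_eq_of_sum_eq {I : Finset (Fin m)} (hI : I ∈ Δ.faces) {r s : Fin m → ℝ}
    (h : ∑ i ∈ I, r i • Δ.ray i = ∑ i ∈ I, s i • Δ.ray i) {i : Fin m} (hi : i ∈ I) : r i = s i := by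
  have key := linearIndependent_iff'.1 (Δ.b_indep I hI) Finset.univ (fun i => r i - s i) ?_
    ⟨i, hi⟩ (Finset.mem_univ _)
  · exact sub_eq_zero.1 key
  · rw [Finset.univ_eq_attach]
    refine (Finset.sum_attach I fun i => (r i - s i) • Δ.ray i).trans ?_
    simp [sub_smul, h]

theorem coeff_eq_zero_of_mem_cone {I J : Finset (Fin m)} (hI : I ∈ Δ.faces) (hJ : J ⊆ I)
    {r : Fin m → ℝ} (h : ∑ i ∈ I, r i • Δ.ray i ∈ cone Δ.ray J) {i : Fin m} (hi : i ∈ I)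
    (hiJ : i ∉ J) : r i = 0 := by
  classical
  obtain ⟨s, -, hs⟩ := h
  have : ∑ i ∈ I, r i • Δ.ray i = ∑ i ∈ I, (if i ∈ J then s i else 0) • Δ.ray i := by
    rw [hs]
    simp [ite_smul, Finset.sum_ite_mem, Finset.inter_eq_right.2 hJ]
  simpa [hiJ] using coeff_eq_of_sum_eq hI this hi

/-- Every simplex of a complete fan is a face of a facet. -/
theorem exists_facet_superset (hc : Δ.IsComplete) (hns : Δ.IsNonsingular) {J : Finset (Fin m)}
    (hJ : J ∈ Δ.faces) : ∃ I : Δ.Facet, J ⊆ I.1 := by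
  obtain ⟨I, hI⟩ := exists_facet_mem_cone hc hns (∑ i ∈ J, (1 : Fin m → ℝ) i • Δ.ray i)
  refine ⟨I, fun j hj => ?_⟩
  by_contra hjI
  have hmem : ∑ i ∈ J, (1 : Fin m → ℝ) i • Δ.ray i ∈ cone Δ.ray (J ∩ I.1) := by
    have h := Δ.cone_inter J hJ I.1 I.2.1
    rw [Set.ext_iff] at h
    exact (h _).1 ⟨⟨1, fun _ => zero_le_one, rfl⟩, hI⟩
  exact one_ne_zero (coeff_eq_zero_of_mem_cone hJ Finset.inter_subset_left hmem hj
    fun h => hjI (Finset.mem_inter.1 h).2)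

/-- Two vector combinations agreeing up to the span of the common face have vanishing coefficients
outside that face. -/
theorem coeff_eq_zero_of_sub_mem_span {I J : Finset (Fin m)} (hI : I ∈ Δ.faces) (hJ : J ∈ Δ.faces)
    {r s : Fin m → ℝ} (hr : ∀ i, 0 ≤ r i) (hs : ∀ i, 0 ≤ s i) (t : Fin m → ℝ)
    (h : ∑ i ∈ I \ J, r i • Δ.ray i - ∑ j ∈ J \ I, s j • Δ.ray j = ∑ k ∈ I ∩ J, t k • Δ.ray k) :
    (∀ i ∈ I \ J, r i = 0) ∧ ∀ j ∈ J \ I, s j = 0 := by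
  classical
  let r' : Fin m → ℝ := fun i => if i ∈ J then (t i)⁻ else r i
  let s' : Fin m → ℝ := fun i => if i ∈ I then (t i)⁺ else s i
  have hr' : ∑ i ∈ I, r' i • Δ.ray i =
      ∑ i ∈ I \ J, r i • Δ.ray i + ∑ k ∈ I ∩ J, (t k)⁻ • Δ.ray k := by
    rw [← Finset.sum_sdiff (Finset.inter_subset_left : I ∩ J ⊆ I), Finset.sdiff_inter_self_left]
    congr 1 <;> refine Finset.sum_congr rfl fun i hi => ?_
    · simp [r', (Finset.mem_sdiff.1 hi).2]
    · simp [r', (Finset.mem_inter.1 hi).2]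
  have hs' : ∑ i ∈ J, s' i • Δ.ray i =
      ∑ i ∈ J \ I, s i • Δ.ray i + ∑ k ∈ I ∩ J, (t k)⁺ • Δ.ray k := by
    rw [← Finset.sum_sdiff (Finset.inter_subset_right : I ∩ J ⊆ J), Finset.sdiff_inter_self_right]
    congr 1 <;> refine Finset.sum_congr rfl fun i hi => ?_
    · simp [s', (Finset.mem_sdiff.1 hi).2]
    · simp [s', (Finset.mem_inter.1 hi).1]
  have heq : ∑ i ∈ I, r' i • Δ.ray i = ∑ i ∈ J, s' i • Δ.ray i := by
    have ht : ∑ k ∈ I ∩ J, t k • Δ.ray k =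
        ∑ k ∈ I ∩ J, (t k)⁺ • Δ.ray k - ∑ k ∈ I ∩ J, (t k)⁻ • Δ.ray k := by
      rw [← Finset.sum_sub_distrib]
      refine Finset.sum_congr rfl fun k _ => ?_
      rw [← sub_smul, posPart_sub_negPart]
    rw [hr', hs', ← sub_eq_zero]
    rw [ht, ← sub_eq_zero] at h
    rw [← h]
    abel
  have hmem : ∑ i ∈ I, r' i • Δ.ray i ∈ cone Δ.ray (I ∩ J) := by
    have h := Δ.cone_inter I hI J hJ
    rw [Set.ext_iff] at h
    refine (h _).1 ⟨⟨r', fun i => ?_, rfl⟩, ⟨s', fun i => ?_, heq⟩⟩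
    · simp only [r']
      split_ifs
      exacts [negPart_nonneg _, hr i]
    · simp only [s']
      split_ifs
      exacts [posPart_nonneg _, hs i]
  constructor
  · intro i hi
    obtain ⟨hiI, hiJ⟩ := Finset.mem_sdiff.1 hi
    have := coeff_eq_zero_of_mem_cone hI Finset.inter_subset_left hmem hiI
      fun h => hiJ (Finset.mem_inter.1 h).2
    simpa [r', hiJ] using this
  · intro j hj
    obtain ⟨hjJ, hjI⟩ := Finset.mem_sdiff.1 hj
    rw [heq] at hmem
    have := coeff_eq_zero_of_mem_cone hJ Finset.inter_subset_right hmem hjJ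
      fun h => hjI (Finset.mem_inter.1 h).1
    simpa [s', hjI] using this

theorem exists_weights_of_mem_convexHull_image {ι E : Type*} [AddCommGroup E] [Module ℝ E]
    {D : Finset ι} {a : ι → E} {x : E} (hx : x ∈ convexHull ℝ (a '' D)) :
    ∃ w : ι → ℝ, (∀ i, 0 ≤ w i) ∧ ∑ i ∈ D, w i = 1 ∧ ∑ i ∈ D, w i • a i = x := by
  classical
  let S : Set E := {x | ∃ w : ι → ℝ, (∀ i, 0 ≤ w i) ∧ ∑ i ∈ D, w i = 1 ∧ ∑ i ∈ D, w i • a i = x}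
  have hS : Convex ℝ S := by
    rintro _ ⟨w, hw0, hw1, rfl⟩ _ ⟨w', hw0', hw1', rfl⟩ p q hp hq hpq
    refine ⟨fun i => p * w i + q * w' i, fun i => ?_, ?_, ?_⟩
    · exact add_nonneg (mul_nonneg hp (hw0 i)) (mul_nonneg hq (hw0' i))
    · rw [Finset.sum_add_distrib, ← Finset.mul_sum, ← Finset.mul_sum, hw1, hw1', mul_one, mul_one, hpq]
    · simp [add_smul, mul_smul, Finset.sum_add_distrib, Finset.smul_sum]
  refine convexHull_min ?_ hS hx
  rintro _ ⟨i, hi, rfl⟩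
  refine ⟨Pi.single i 1, fun j => ?_, ?_, ?_⟩
  · by_cases h : j = i
    · subst h; simp
    · simp [h]
  · simpa [Finset.sum_pi_single'] using hi
  · rw [Finset.sum_eq_single_of_mem i hi fun j _ h => by simp [h]]
    simp

/-- The cones of two simplices are separated by a hyperplane meeting them in the common face. -/
theorem exists_separating {I J : Finset (Fin m)} (hI : I ∈ Δ.faces) (hJ : J ∈ Δ.faces) :
    ∃ f : (Fin n → ℝ) →L[ℝ] ℝ, (∀ i ∈ I \ J, 0 < f (Δ.ray i)) ∧ (∀ j ∈ J \ I, f (Δ.ray j) < 0) ∧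
      ∀ k ∈ I ∩ J, f (Δ.ray k) = 0 := by
  classical
  let D : Finset (Fin m) := (I \ J) ∪ (J \ I)
  let a : Fin m → Fin n → ℝ := fun i => if i ∈ I then Δ.ray i else -Δ.ray i
  let K : Set (Fin n → ℝ) := convexHull ℝ (a '' D)
  let L : Submodule ℝ (Fin n → ℝ) := Submodule.span ℝ (Δ.ray '' ↑(I ∩ J))
  have hK : IsCompact K := (D.finite_toSet.image a).isCompact_convexHull ℝ
  have hdisj : Disjoint K (L : Set (Fin n → ℝ)) := by
    refine Set.disjoint_left.2 fun x hxK hxL => ?_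
    obtain ⟨w, hw0, hw1, rfl⟩ := exists_weights_of_mem_convexHull_image hxK
    obtain ⟨t, ht⟩ := (Submodule.mem_span_image_finset_iff_exists_fun' ℝ).1 hxL
    have hdis : Disjoint (I \ J) (J \ I) := disjoint_sdiff_sdiff
    have hsum : ∑ i ∈ D, w i • a i = ∑ i ∈ I \ J, w i • Δ.ray i - ∑ j ∈ J \ I, w j • Δ.ray j := by
      rw [Finset.sum_union hdis, sub_eq_add_neg, ← Finset.sum_neg_distrib]
      congr 1 <;> refine Finset.sum_congr rfl fun i hi => ?_
      · simp [a, (Finset.mem_sdiff.1 hi).1]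
      · simp [a, (Finset.mem_sdiff.1 hi).2]
    obtain ⟨h1, h2⟩ := coeff_eq_zero_of_sub_mem_span hI hJ hw0 hw0 t (by rw [← hsum, ht])
    rw [Finset.sum_union hdis, Finset.sum_eq_zero h1, Finset.sum_eq_zero h2] at hw1
    norm_num at hw1
  obtain ⟨f, u, v, hu, huv, hv⟩ := geometric_hahn_banach_compact_closed (convex_convexHull ℝ _) hK
    L.convex L.closed_of_finiteDimensional hdisj
  have hL : ∀ y ∈ L, f y = 0 := by
    intro y hy
    by_contra hne
    have := hv (((v - 1) / f y) • y) (L.smul_mem _ hy)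
    rw [map_smul, smul_eq_mul, div_mul_cancel₀ _ hne] at this
    linarith
  have hv0 : v < 0 := by simpa using hv 0 L.zero_mem
  have ha : ∀ i ∈ D, f (a i) < 0 := fun i hi =>
    ((hu _ (subset_convexHull ℝ _ ⟨i, hi, rfl⟩)).trans huv).trans hv0
  refine ⟨-f, fun i hi => ?_, fun j hj => ?_, fun k hk => ?_⟩
  · have := ha i (Finset.mem_union_left _ hi)
    simpa [a, (Finset.mem_sdiff.1 hi).1] using this
  · have := ha j (Finset.mem_union_right _ hj)
    simpa [a, (Finset.mem_sdiff.1 hj).2] using this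
  · simpa using hL _ (Submodule.subset_span ⟨k, hk, rfl⟩)

end TopologicalFan

namespace TopologicalFan

variable {n m : ℕ} {Δ : TopologicalFan n m}

theorem isOpen_coordOpen (I : Finset (Fin m)) : IsOpen (coordOpen I) := by
  have : coordOpen I = ⋂ i, ⋂ _ : i ∉ I, {z : Fin m → ℂ | z i ≠ 0} := by
    ext z
    simp [coordOpen]
  rw [this]
  exact isOpen_iInter_of_finite fun i => isOpen_iInter_of_finite fun _ =>
    isOpen_ne_fun (continuous_apply i) continuous_const

theorem isOpen_U (Δ : TopologicalFan n m) : IsOpen Δ.U :=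
  isOpen_biUnion fun I _ => isOpen_coordOpen I

theorem coordOpen_subset_U {I : Finset (Fin m)} (hI : I ∈ Δ.faces) : coordOpen I ⊆ Δ.U :=
  Set.subset_biUnion_of_mem (u := fun I : Finset (Fin m) => (coordOpen I : Set (Fin m → ℂ))) hI

@[simp] theorem coe_smul (h : Torus m) (z : Δ.U) :
    ((h • z : Δ.U) : Fin m → ℂ) = (h : Fin m → ℂ) * (z : Fin m → ℂ) := rfl

theorem torus_apply_ne_zero (h : Torus m) (k : Fin m) : (h : Fin m → ℂ) k ≠ 0 :=
  (Torus.coord k h).ne_zero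

theorem smul_mem_coordOpen_iff {I : Finset (Fin m)} (h : Torus m) (z : Δ.U) :
    ((h • z : Δ.U) : Fin m → ℂ) ∈ coordOpen I ↔ (z : Fin m → ℂ) ∈ coordOpen I := by
  simp [coordOpen, torus_apply_ne_zero h]

theorem proj_eq_proj_iff {z w : Δ.U} :
    Δ.proj z = Δ.proj w ↔ ∃ h : Torus m, Δ.lam h = 1 ∧ h • w = z := by
  refine Quotient.eq.trans ?_
  rw [MulAction.orbitRel_apply]
  exact ⟨fun ⟨h, e⟩ => ⟨h.1, h.2, e⟩, fun ⟨h, h1, e⟩ => ⟨⟨h, h1⟩, e⟩⟩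

theorem proj_surjective (Δ : TopologicalFan n m) : Function.Surjective Δ.proj :=
  Quotient.mk_surjective

instance : ContinuousConstSMul Δ.lam.ker Δ.U where
  continuous_const_smul _ :=
    Continuous.subtype_mk (continuous_const.mul continuous_subtype_val) _

theorem isOpenQuotientMap_proj (Δ : TopologicalFan n m) : IsOpenQuotientMap Δ.proj :=
  MulAction.isOpenQuotientMap_quotientMk

theorem Facet.proj_mem_domain_iff {I : Δ.Facet} {z : Δ.U} :
    Δ.proj z ∈ I.domain ↔ (z : Fin m → ℂ) ∈ coordOpen I.1 := by
  constructor
  · rintro ⟨w, hw, e⟩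
    obtain ⟨h, -, rfl⟩ := proj_eq_proj_iff.1 e
    exact (smul_mem_coordOpen_iff h z).1 hw
  · exact fun h => ⟨z, h, rfl⟩

theorem Facet.isOpen_domain (I : Δ.Facet) : IsOpen I.domain :=
  Δ.isOpenQuotientMap_proj.isOpenMap _
    ((isOpen_coordOpen I.1).preimage continuous_subtype_val)

theorem exists_mem_domain (hc : Δ.IsComplete) (hns : Δ.IsNonsingular) (x : Δ.X) :
    ∃ I : Δ.Facet, x ∈ I.domain := by
  obtain ⟨z, rfl⟩ := Δ.proj_surjective x
  obtain ⟨J, hJ, hz⟩ := Set.mem_iUnion₂.1 z.2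
  obtain ⟨I, hI⟩ := exists_facet_superset hc hns hJ
  exact ⟨I, Facet.proj_mem_domain_iff.2 fun i hi => hz i fun h => hi (hI h)⟩

/-- The point `[1, …, 1]` upstairs. -/
def basePoint (Δ : TopologicalFan n m) : Δ.U :=
  ⟨1, coordOpen_subset_U Δ.empty_mem fun _ _ => one_ne_zero⟩

@[simp] theorem coe_smul_basePoint (h : Torus m) :
    ((h • Δ.basePoint : Δ.U) : Fin m → ℂ) = h := mul_one _

theorem range_smul_basePoint (Δ : TopologicalFan n m) :
    Set.range (fun h : Torus m => h • Δ.basePoint) =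
      {z : Δ.U | (z : Fin m → ℂ) ∈ coordOpen ∅} := by
  ext z
  constructor
  · rintro ⟨h, rfl⟩
    intro i _
    rw [coe_smul_basePoint]
    exact torus_apply_ne_zero h i
  · intro hz
    refine ⟨Torus.mk fun k => Units.mk0 (z.1 k) (hz k (Finset.notMem_empty k)), Subtype.ext ?_⟩
    rw [coe_smul_basePoint]
    rfl

theorem isOpen_range_proj_basePoint (Δ : TopologicalFan n m) :
    IsOpen (Set.range fun h : Torus m => Δ.proj (h • Δ.basePoint)) := by
  rw [Set.range_comp' Δ.proj, range_smul_basePoint]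
  exact Δ.isOpenQuotientMap_proj.isOpenMap _
    ((isOpen_coordOpen ∅).preimage continuous_subtype_val)

theorem denseRange_proj_basePoint (Δ : TopologicalFan n m) :
    DenseRange fun h : Torus m => Δ.proj (h • Δ.basePoint) := by
  have hd : Dense (coordOpen (∅ : Finset (Fin m)) : Set (Fin m → ℂ)) := by
    have h := dense_pi (Set.univ : Set (Fin m)) (s := fun _ => ({0}ᶜ : Set ℂ))
      fun _ _ => dense_compl_singleton 0
    convert h using 1
    ext z
    simp [coordOpen]
  rw [DenseRange, Set.range_comp' Δ.proj, range_smul_basePoint]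
  exact Δ.proj_surjective.denseRange.dense_image Δ.isOpenQuotientMap_proj.continuous
    (hd.preimage Δ.isOpen_U.isOpenMap_subtype_val)

namespace Facet

variable (I : Δ.Facet) {α : Fin n → Fin n → Exponent}

theorem chartMap_mul (α : Fin n → Fin n → Exponent) (z w : Fin m → ℂ) :
    I.chartMap α (z * w) = I.chartMap α z * I.chartMap α w := by
  ext i
  simp only [chartMap, Pi.mul_apply, cpw_mul, Finset.prod_mul_distrib]
  ring

variable {I}

theorem IsDual.chartMap_coe (hα : I.IsDual α) (h : Torus m) (i : Fin n) :
    I.chartMap α h i = chi (α i) (Δ.lam h) := by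
  have key : ∏ k ∈ I.1, cpw ((h : Fin m → ℂ) k) (pairing (α i) (Δ.β k)) =
      (h : Fin m → ℂ) (I.enum i) := by
    rw [← I.prod_enum, Finset.prod_eq_single i]
    · rw [hα i i, if_pos rfl, cpw_one_right (torus_apply_ne_zero h _)]
    · intro j _ hj
      rw [hα i j, if_neg hj.symm, cpw_zero]
    · simp
  rw [chi_lam, Units.coe_prod]
  simp only [coe_powHom, Torus.coe_coord]
  rw [← Finset.prod_mul_prod_compl I.1, key]
  rfl

theorem IsDual.chartMap_smul (hα : I.IsDual α) (h : Torus m) (z : Δ.U) (i : Fin n) :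
    I.chartMap α (h • z : Δ.U) i = chi (α i) (Δ.lam h) * I.chartMap α z i := by
  rw [coe_smul, chartMap_mul, Pi.mul_apply, hα.chartMap_coe]

theorem contDiffAt_chartMap {z : Fin m → ℂ} (hz : z ∈ coordOpen I.1) :
    ContDiffAt ℝ ∞ (I.chartMap α) z := by
  refine contDiffAt_pi.2 fun i => ?_
  refine (contDiff_apply ℝ ℂ (I.enum i)).contDiffAt.mul (contDiffAt_prod fun k hk => ?_)
  exact (contDiffAt_cpw (hz k (Finset.mem_compl.1 hk)) _).comp z
    (contDiff_apply ℝ ℂ k).contDiffAt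

variable (I)

/-- The section of the chart of a facet `I`: the coordinates outside `I` are set to `1`. -/
def lift (w : Fin n → ℂ) : Fin m → ℂ := Function.extend I.enum w 1

@[simp] theorem lift_enum (w : Fin n → ℂ) (i : Fin n) : I.lift w (I.enum i) = w i :=
  I.enum.injective.extend_apply _ _ _

theorem lift_of_notMem (w : Fin n → ℂ) {k : Fin m} (hk : k ∉ I.1) : I.lift w k = 1 :=
  Function.extend_apply' _ _ _ (by rwa [← I.mem_iff_exists_enum])

theorem lift_mem (w : Fin n → ℂ) : I.lift w ∈ coordOpen I.1 := fun k hk => by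
  simp [I.lift_of_notMem w hk]

theorem contDiff_lift : ContDiff ℝ ∞ I.lift := by
  refine contDiff_pi.2 fun k => ?_
  by_cases hk : k ∈ I.1
  · obtain ⟨i, rfl⟩ := I.mem_iff_exists_enum.1 hk
    simpa using contDiff_apply ℝ ℂ i
  · simpa [I.lift_of_notMem _ hk] using contDiff_const

/-- The section as a map to `U(Σ)`. -/
def sect (w : Fin n → ℂ) : Δ.U := ⟨I.lift w, coordOpen_subset_U I.2.1 (I.lift_mem w)⟩

theorem continuous_sect : Continuous I.sect := I.contDiff_lift.continuous.subtype_mk _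

theorem chartMap_lift (α : Fin n → Fin n → Exponent) (w : Fin n → ℂ) :
    I.chartMap α (I.lift w) = w := by
  ext i
  rw [chartMap, lift_enum, Finset.prod_eq_one, mul_one]
  intro k hk
  rw [I.lift_of_notMem w (Finset.mem_compl.1 hk), cpw_one]

variable {I}

theorem IsDual.proj_sect_chartMap (hα : I.IsDual α) (hns : Δ.IsNonsingular) {z : Δ.U}
    (hz : (z : Fin m → ℂ) ∈ coordOpen I.1) : Δ.proj (I.sect (I.chartMap α z)) = Δ.proj z := by
  have hp : ∀ i, ∏ k ∈ I.1ᶜ, cpw (z.1 k) (pairing (α i) (Δ.β k)) ≠ 0 := fun i =>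
    Finset.prod_ne_zero_iff.2 fun k hk => cpw_ne_zero (hz k (Finset.mem_compl.1 hk)) _
  let p : Fin n → ℂ := fun i => (∏ k ∈ I.1ᶜ, cpw (z.1 k) (pairing (α i) (Δ.β k)))⁻¹
  let f : Fin m → ℂ := Function.extend I.enum p z.1
  have hfe : ∀ i, f (I.enum i) = p i := fun i => I.enum.injective.extend_apply _ _ _
  have hfc : ∀ k, k ∉ I.1 → f k = z.1 k := fun k hk =>
    Function.extend_apply' _ _ _ (by rwa [← I.mem_iff_exists_enum])
  have hf : ∀ k, f k ≠ 0 := fun k => by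
    by_cases hk : k ∈ I.1
    · obtain ⟨i, rfl⟩ := I.mem_iff_exists_enum.1 hk
      rw [hfe]
      exact inv_ne_zero (hp i)
    · rw [hfc k hk]
      exact hz k hk
  let h : Torus m := Torus.mk fun k => Units.mk0 (f k) (hf k)
  have hh : (h : Fin m → ℂ) = f := rfl
  refine (proj_eq_proj_iff.2 ⟨h, hα.eq_one hns fun i => Units.ext ?_, Subtype.ext ?_⟩).symm
  · rw [← hα.chartMap_coe, hh, chartMap, hfe, Units.val_one]
    rw [Finset.prod_congr rfl fun k hk => by rw [hfc k (Finset.mem_compl.1 hk)]]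
    exact inv_mul_cancel₀ (hp i)
  · ext k
    rw [coe_smul, Pi.mul_apply, hh]
    change f k * I.lift _ k = _
    by_cases hk : k ∈ I.1
    · obtain ⟨i, rfl⟩ := I.mem_iff_exists_enum.1 hk
      rw [hfe, lift_enum, chartMap, mul_left_comm, inv_mul_cancel₀ (hp i), mul_one]
    · rw [hfc k hk, I.lift_of_notMem _ hk, mul_one]

/-- The map of the quotient induced by `chartMap`. -/
def IsDual.chartFun (hα : I.IsDual α) : Δ.X → Fin n → ℂ :=
  Quotient.lift (fun z : Δ.U => I.chartMap α z) fun z w hzw => by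
    obtain ⟨h, hh, rfl⟩ := proj_eq_proj_iff.1 (Quotient.sound hzw : Δ.proj z = Δ.proj w)
    ext i
    rw [hα.chartMap_smul, hh, map_one, Units.val_one, one_mul]

@[simp] theorem IsDual.chartFun_proj (hα : I.IsDual α) (z : Δ.U) :
    hα.chartFun (Δ.proj z) = I.chartMap α z := rfl

theorem IsDual.continuousOn_chartFun (hα : I.IsDual α) : ContinuousOn hα.chartFun I.domain := by
  rintro _ ⟨z, hz, rfl⟩
  refine (Δ.isOpenQuotientMap_proj.continuousAt_comp_iff.1 ?_).continuousWithinAt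
  exact ((contDiffAt_chartMap hz).continuousAt (x := z.1)).comp continuous_subtype_val.continuousAt

/-- The chart of `X(Δ)` attached to a facet. -/
def IsDual.chart (hα : I.IsDual α) (hns : Δ.IsNonsingular) :
    OpenPartialHomeomorph Δ.X (Fin n → ℂ) where
  toFun := hα.chartFun
  invFun w := Δ.proj (I.sect w)
  source := I.domain
  target := Set.univ
  map_source' _ _ := Set.mem_univ _
  map_target' w _ := proj_mem_domain_iff.2 (I.lift_mem w)
  left_inv' := by
    rintro _ ⟨z, hz, rfl⟩
    exact hα.proj_sect_chartMap hns hz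
  right_inv' w _ := I.chartMap_lift α w
  open_source := I.isOpen_domain
  open_target := isOpen_univ
  continuousOn_toFun := hα.continuousOn_chartFun
  continuousOn_invFun :=
    (Δ.isOpenQuotientMap_proj.continuous.comp I.continuous_sect).continuousOn

theorem IsDual.contDiffOn_transition {J : Δ.Facet} {γ : Fin n → Fin n → Exponent}
    (hα : I.IsDual α) (hγ : J.IsDual γ) (hns : Δ.IsNonsingular) {s : Set (Fin n → ℂ)}
    (hs : ∀ w ∈ s, (hα.chart hns).symm w ∈ J.domain) :
    ContDiffOn ℝ ∞ (hγ.chart hns ∘ (hα.chart hns).symm) s := by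
  intro w hw
  have hmem : I.lift w ∈ coordOpen J.1 := proj_mem_domain_iff.1 (hs w hw)
  exact ((contDiffAt_chartMap hmem).comp w I.contDiff_lift.contDiffAt).contDiffWithinAt

end Facet

/-- The action of `(ℂ*)ⁿ` on `X(Δ)` induced from that of `(ℂ*)ᵐ` on `U(Σ)` through `λ`. -/
def torusSMul (hs : Function.Surjective Δ.lam) (g : Torus n) : Δ.X → Δ.X :=
  Quotient.lift (fun z : Δ.U => Δ.proj (Function.surjInv hs g • z)) fun z w hzw => by
    obtain ⟨h, hh, rfl⟩ := proj_eq_proj_iff.1 (Quotient.sound hzw : Δ.proj z = Δ.proj w)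
    exact proj_eq_proj_iff.2 ⟨h, hh, smul_comm _ _ _⟩

theorem torusSMul_lam (hs : Function.Surjective Δ.lam) (h : Torus m) (z : Δ.U) :
    torusSMul hs (Δ.lam h) (Δ.proj z) = Δ.proj (h • z) := by
  refine proj_eq_proj_iff.2 ⟨Function.surjInv hs (Δ.lam h) * h⁻¹, ?_, ?_⟩
  · rw [map_mul, map_inv, Function.surjInv_eq hs, mul_inv_cancel]
  · rw [smul_smul, inv_mul_cancel_right]

/-- The action of `(ℂ*)ⁿ` on `X(Δ)`. -/
@[reducible]
def torusAction (hs : Function.Surjective Δ.lam) : MulAction (Torus n) Δ.X where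
  smul := torusSMul hs
  one_smul x := by
    obtain ⟨z, rfl⟩ := Δ.proj_surjective x
    have := torusSMul_lam hs 1 z
    rwa [map_one, one_smul] at this
  mul_smul g g' x := by
    obtain ⟨z, rfl⟩ := Δ.proj_surjective x
    obtain ⟨h, rfl⟩ := hs g
    obtain ⟨h', rfl⟩ := hs g'
    change torusSMul hs _ _ = torusSMul hs _ (torusSMul hs _ _)
    rw [← map_mul, torusSMul_lam, torusSMul_lam, torusSMul_lam, mul_smul]

end TopologicalFan

theorem contMDiff_coe_chi {n : ℕ} (α : Fin n → Exponent) :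
    ContMDiff 𝓘(ℝ, Fin n → ℂ) 𝓘(ℝ, ℂ) ∞ (fun g : Torus n => (chi α g : ℂ)) := by
  have h : (fun g : Torus n => (chi α g : ℂ)) =
      (fun z : Fin n → ℂ => ∏ k, cpw (z k) (α k)) ∘ Units.val := by
    ext g
    simp [chi_apply]
  rw [h]
  intro g
  refine ContMDiffAt.comp g ?_ (Units.contMDiff_val g)
  rw [contMDiffAt_iff_contDiffAt]
  exact contDiffAt_prod fun k _ => (contDiffAt_cpw (Torus.coord k g).ne_zero _).comp (g : Fin n → ℂ)
    (contDiff_apply ℝ ℂ k).contDiffAt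

theorem contMDiff_chi {n : ℕ} (α : Fin n → Exponent) :
    ContMDiff 𝓘(ℝ, Fin n → ℂ) 𝓘(ℝ, ℂ) ∞ (chi α) :=
  ContMDiff.of_comp_isOpenEmbedding Units.isOpenEmbedding_val (contMDiff_coe_chi α)

/-- The vector of the logarithms of the absolute values of the coordinates. -/
def logVec {n : ℕ} (g : Torus n) : Fin n → ℝ := fun k => Real.log ‖(g : Fin n → ℂ) k‖

theorem log_norm_chi {n : ℕ} (α : Fin n → Exponent) (g : Torus n) :
    Real.log ‖(chi α g : ℂ)‖ = ∑ k, (α k).b * logVec g k := by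
  rw [chi_apply, Units.coe_prod, norm_prod, Real.log_prod fun k _ => norm_ne_zero_iff.2 (Units.ne_zero _)]
  refine Finset.sum_congr rfl fun k _ => ?_
  rw [coe_powHom, norm_cpw (Units.ne_zero _), Real.log_rpow (norm_pos_iff.2 (Units.ne_zero _))]
  rfl

namespace TopologicalFan

variable {n m : ℕ} {Δ : TopologicalFan n m}

namespace Facet

variable {I : Δ.Facet} {α : Fin n → Fin n → Exponent}

/-- In the chart of a facet, the function `|z|^f` of the open orbit. -/
theorem IsDual.prod_norm_chi_rpow (hα : I.IsDual α) (hns : Δ.IsNonsingular)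
    (f : (Fin n → ℝ) →L[ℝ] ℝ) (g : Torus n) :
    ∏ i, ‖(chi (α i) g : ℂ)‖ ^ f (Δ.ray (I.enum i)) = Real.exp (f (logVec g)) := by
  conv_rhs => rw [← hα.sum_smul_ray hns (logVec g)]
  rw [map_sum, Real.exp_sum]
  refine Finset.prod_congr rfl fun i _ => ?_
  rw [Real.rpow_def_of_pos (norm_pos_iff.2 (Units.ne_zero _)), log_norm_chi, map_smul, smul_eq_mul]

/-- The function `∏ᵢ |wᵢ|^f(bᵢ)` in the chart of a facet. -/
def IsDual.monomial (hα : I.IsDual α) (f : (Fin n → ℝ) →L[ℝ] ℝ) (x : Δ.X) : ℝ :=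
  ∏ i, ‖hα.chartFun x i‖ ^ f (Δ.ray (I.enum i))

theorem IsDual.monomial_nonneg (hα : I.IsDual α) (f : (Fin n → ℝ) →L[ℝ] ℝ) (x : Δ.X) :
    0 ≤ hα.monomial f x :=
  Finset.prod_nonneg fun _ _ => Real.rpow_nonneg (norm_nonneg _) _

theorem IsDual.monomial_proj_basePoint (hα : I.IsDual α) (hns : Δ.IsNonsingular)
    (f : (Fin n → ℝ) →L[ℝ] ℝ) (h : Torus m) :
    hα.monomial f (Δ.proj (h • Δ.basePoint)) = Real.exp (f (logVec (Δ.lam h))) := by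
  rw [← hα.prod_norm_chi_rpow hns]
  simp only [monomial, chartFun_proj, coe_smul_basePoint, hα.chartMap_coe]

theorem IsDual.continuousOn_monomial (hα : I.IsDual α) {f : (Fin n → ℝ) →L[ℝ] ℝ}
    (hf : ∀ k ∈ I.1, 0 ≤ f (Δ.ray k)) : ContinuousOn (hα.monomial f) I.domain := by
  refine continuousOn_finsetProd _ fun i _ => ContinuousOn.rpow_const ?_ fun _ _ =>
    Or.inr (hf _ (I.enum_mem i))
  exact ((continuous_apply i).comp_continuousOn hα.continuousOn_chartFun).norm

theorem IsDual.monomial_eq_zero (hα : I.IsDual α) {f : (Fin n → ℝ) →L[ℝ] ℝ} {z : Δ.U}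
    {k : Fin m} (hkI : k ∈ I.1) (hk : f (Δ.ray k) ≠ 0) (hzk : (z : Fin m → ℂ) k = 0) :
    hα.monomial f (Δ.proj z) = 0 := by
  obtain ⟨i, rfl⟩ := I.mem_iff_exists_enum.1 hkI
  refine Finset.prod_eq_zero (Finset.mem_univ i) ?_
  rw [chartFun_proj, chartMap, hzk, zero_mul, norm_zero, Real.zero_rpow hk]

end Facet

/-- Points which do not lie in a common chart are separated by a monomial function. -/
theorem exists_disjoint_nhds {I J : Δ.Facet} (hns : Δ.IsNonsingular) {x y : Δ.X}
    (hx : x ∈ I.domain) (hy : y ∈ J.domain) (hxJ : x ∉ J.domain) :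
    ∃ V W : Set Δ.X, IsOpen V ∧ IsOpen W ∧ x ∈ V ∧ y ∈ W ∧ Disjoint V W := by
  obtain ⟨α, hα, -⟩ := I.existsUnique_isDual hns
  obtain ⟨γ, hγ, -⟩ := J.existsUnique_isDual hns
  obtain ⟨f, hI, hJ, hIJ⟩ := exists_separating I.2.1 J.2.1
  have hfI : ∀ k ∈ I.1, 0 ≤ f (Δ.ray k) := fun k hk => by
    by_cases h : k ∈ J.1
    · exact (hIJ k (Finset.mem_inter.2 ⟨hk, h⟩)).ge
    · exact (hI k (Finset.mem_sdiff.2 ⟨hk, h⟩)).le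
  have hfJ : ∀ k ∈ J.1, 0 ≤ (-f) (Δ.ray k) := fun k hk => by
    by_cases h : k ∈ I.1
    · simpa using (hIJ k (Finset.mem_inter.2 ⟨h, hk⟩)).le
    · simpa using (hJ k (Finset.mem_sdiff.2 ⟨hk, h⟩)).le
  have hx0 : hα.monomial f x = 0 := by
    obtain ⟨z, rfl⟩ := Δ.proj_surjective x
    rw [Facet.proj_mem_domain_iff] at hx hxJ
    simp only [coordOpen, Set.mem_ofPred_eq, not_forall, not_not] at hxJ
    obtain ⟨k, hkJ, hk⟩ := hxJ
    have hkI : k ∈ I.1 := by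
      by_contra h
      exact hx k h hk
    exact hα.monomial_eq_zero hkI (hI k (Finset.mem_sdiff.2 ⟨hkI, hkJ⟩)).ne' hk
  have hM := hγ.monomial_nonneg (-f) y
  set M := hγ.monomial (-f) y with hMdef
  have hV := (hα.continuousOn_monomial hfI).isOpen_inter_preimage I.isOpen_domain
    (isOpen_Iio (a := (M + 1)⁻¹))
  have hW := (hγ.continuousOn_monomial hfJ).isOpen_inter_preimage J.isOpen_domain
    (isOpen_Iio (a := M + 1))
  refine ⟨_, _, hV, hW, ⟨hx, ?_⟩, ⟨hy, ?_⟩, ?_⟩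
  · rw [Set.mem_preimage, hx0, Set.mem_Iio]
    exact inv_pos.2 (by linarith)
  · rw [Set.mem_preimage, ← hMdef]
    exact lt_add_one M
  · rw [Set.disjoint_iff_inter_eq_empty]
    by_contra hne
    obtain ⟨h, ⟨-, h1⟩, -, h2⟩ := Δ.denseRange_proj_basePoint.exists_mem_open (hV.inter hW)
      (Set.nonempty_iff_ne_empty.2 hne)
    rw [Set.mem_preimage, Set.mem_Iio, hα.monomial_proj_basePoint hns] at h1
    rw [Set.mem_preimage, Set.mem_Iio, hγ.monomial_proj_basePoint hns] at h2
    have h3 := mul_lt_mul'' h1 h2 (Real.exp_pos _).le (Real.exp_pos _).le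
    rw [← Real.exp_add, inv_mul_cancel₀ (by linarith)] at h3
    simp at h3

theorem t2Space_X (hc : Δ.IsComplete) (hns : Δ.IsNonsingular) : T2Space Δ.X := by
  refine ⟨fun x y hxy => ?_⟩
  obtain ⟨I, hx⟩ := exists_mem_domain hc hns x
  obtain ⟨J, hy⟩ := exists_mem_domain hc hns y
  by_cases hxJ : x ∈ J.domain
  · obtain ⟨γ, hγ, -⟩ := J.existsUnique_isDual hns
    have hne : hγ.chart hns x ≠ hγ.chart hns y := fun h => hxy ((hγ.chart hns).injOn hxJ hy h)
    obtain ⟨V, W, hV, hW, hxV, hyW, hd⟩ := t2_separation hne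
    exact ⟨_, _, (hγ.chart hns).isOpen_inter_preimage hV, (hγ.chart hns).isOpen_inter_preimage hW,
      ⟨hxJ, hxV⟩, ⟨hy, hyW⟩, (hd.preimage _).mono Set.inter_subset_right Set.inter_subset_right⟩
  · exact exists_disjoint_nhds hns hx hy hxJ

/-- `X(Δ)` is the union of the closed unit polydiscs in the charts of the facets. -/
theorem compactSpace_X (hc : Δ.IsComplete) (hns : Δ.IsNonsingular) : CompactSpace Δ.X := by
  have := t2Space_X hc hns
  let T : Set Δ.X := ⋃ I : Δ.Facet, (fun w => Δ.proj (I.sect w)) '' Metric.closedBall 0 1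
  have hT : IsCompact T := isCompact_iUnion fun I => (isCompact_closedBall 0 1).image
    (Δ.isOpenQuotientMap_proj.continuous.comp I.continuous_sect)
  have hsub : Set.range (fun h : Torus m => Δ.proj (h • Δ.basePoint)) ⊆ T := by
    rintro _ ⟨h, rfl⟩
    obtain ⟨I, hI⟩ := exists_facet_mem_cone hc hns (-logVec (Δ.lam h))
    obtain ⟨α, hα, -⟩ := I.existsUnique_isDual hns
    refine Set.mem_iUnion.2 ⟨I, I.chartMap α (h • Δ.basePoint : Δ.U), ?_,
      hα.proj_sect_chartMap hns fun i _ => ?_⟩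
    · rw [mem_closedBall_zero_iff, pi_norm_le_iff_of_nonneg zero_le_one]
      intro i
      have h0 := (hα.mem_cone_iff hns).1 hI i
      simp only [Pi.neg_apply, mul_neg, Finset.sum_neg_distrib, ← log_norm_chi] at h0
      rw [coe_smul_basePoint, hα.chartMap_coe]
      exact (Real.log_nonpos_iff (norm_nonneg _)).1 (by linarith)
    · rw [coe_smul_basePoint]
      exact torus_apply_ne_zero h i
  have huniv : T = Set.univ :=
    Set.univ_subset_iff.1 (Δ.denseRange_proj_basePoint.closure_eq ▸
      closure_minimal hsub hT.isClosed)
  exact ⟨huniv ▸ hT⟩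

/-- The charts of the facets as an atlas of `X(Δ)`. -/
@[reducible]
def chartedSpace (hc : Δ.IsComplete) (hns : Δ.IsNonsingular)
    {α : Δ.Facet → Fin n → Fin n → Exponent} (hα : ∀ I : Δ.Facet, I.IsDual (α I)) :
    ChartedSpace (Fin n → ℂ) Δ.X where
  atlas := Set.range fun I => (hα I).chart hns
  chartAt x := (hα (exists_mem_domain hc hns x).choose).chart hns
  mem_chart_source x := (exists_mem_domain hc hns x).choose_spec
  chart_mem_atlas _ := ⟨_, rfl⟩

section Manifold

variable (hc : Δ.IsComplete) (hns : Δ.IsNonsingular)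
  {α : Δ.Facet → Fin n → Fin n → Exponent} (hα : ∀ I : Δ.Facet, I.IsDual (α I))

theorem isManifold_X :
    letI := chartedSpace hc hns hα
    IsManifold 𝓘(ℝ, Fin n → ℂ) ∞ Δ.X := by
  let _ := chartedSpace hc hns hα
  refine isManifold_of_contDiffOn _ _ _ ?_
  rintro _ _ ⟨I, rfl⟩ ⟨J, rfl⟩
  simp only [modelWithCornersSelf_coe, modelWithCornersSelf_coe_symm, Function.id_comp,
    Function.comp_id, Set.range_id, Set.preimage_id, Set.inter_univ]
  exact (hα I).contDiffOn_transition (hα J) hns fun w hw => hw.2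

theorem chart_mem_maximalAtlas (I : Δ.Facet) :
    letI := chartedSpace hc hns hα
    (hα I).chart hns ∈ IsManifold.maximalAtlas 𝓘(ℝ, Fin n → ℂ) ∞ Δ.X := by
  let _ := chartedSpace hc hns hα
  have := isManifold_X hc hns hα
  exact IsManifold.subset_maximalAtlas ⟨I, rfl⟩

theorem contMDiffOn_chart (I : Δ.Facet) :
    letI := chartedSpace hc hns hα
    ContMDiffOn 𝓘(ℝ, Fin n → ℂ) 𝓘(ℝ, Fin n → ℂ) ∞ ((hα I).chart hns) I.domain :=
  let _ := chartedSpace hc hns hα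
  have := isManifold_X hc hns hα
  contMDiffOn_of_mem_maximalAtlas (chart_mem_maximalAtlas hc hns hα I)

theorem contMDiff_chart_symm (I : Δ.Facet) :
    letI := chartedSpace hc hns hα
    ContMDiff 𝓘(ℝ, Fin n → ℂ) 𝓘(ℝ, Fin n → ℂ) ∞ ((hα I).chart hns).symm :=
  let _ := chartedSpace hc hns hα
  have := isManifold_X hc hns hα
  contMDiffOn_univ.1 (contMDiffOn_symm_of_mem_maximalAtlas (chart_mem_maximalAtlas hc hns hα I))

theorem Facet.IsDual.smul_mem_domain_and_chart_smul {I : Δ.Facet} {γ : Fin n → Fin n → Exponent}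
    (hγ : I.IsDual γ) (hs : Function.Surjective Δ.lam) (g : Torus n) {x : Δ.X}
    (hx : x ∈ I.domain) :
    letI := torusAction hs
    g • x ∈ I.domain ∧ ∀ i, hγ.chart hns (g • x) i = chi (γ i) g * hγ.chart hns x i := by
  let _ := torusAction hs
  obtain ⟨z, rfl⟩ := Δ.proj_surjective x
  obtain ⟨h, rfl⟩ := hs g
  have e : Δ.lam h • Δ.proj z = Δ.proj (h • z) := torusSMul_lam hs h z
  rw [e]
  exact ⟨proj_mem_domain_iff.2 ((smul_mem_coordOpen_iff h z).2 (proj_mem_domain_iff.1 hx)),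
    hγ.chartMap_smul h z⟩

theorem contMDiff_torusAction (hs : Function.Surjective Δ.lam) :
    letI := torusAction hs
    letI := chartedSpace hc hns hα
    ContMDiff (𝓘(ℝ, Fin n → ℂ).prod 𝓘(ℝ, Fin n → ℂ)) 𝓘(ℝ, Fin n → ℂ) ∞
      (fun p : Torus n × Δ.X => p.1 • p.2) := by
  let _ := torusAction hs
  let _ := chartedSpace hc hns hα
  rintro ⟨g, x⟩
  obtain ⟨I, hx⟩ := exists_mem_domain hc hns x
  let e := (hα I).chart hns
  have hopen : {p : Torus n × Δ.X | p.2 ∈ I.domain} ∈ nhds (g, x) :=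
    (I.isOpen_domain.preimage continuous_snd).mem_nhds hx
  have hev : (fun p : Torus n × Δ.X => p.1 • p.2) =ᶠ[nhds (g, x)]
      fun p => e.symm fun i => (chi (α I i) p.1 : ℂ) * e p.2 i := by
    filter_upwards [hopen] with p hp
    obtain ⟨h1, h2⟩ := (hα I).smul_mem_domain_and_chart_smul hns hs p.1 hp
    rw [← funext h2]
    exact (e.left_inv h1).symm
  refine ContMDiffAt.congr_of_eventuallyEq ?_ hev
  refine ContMDiffAt.comp (g, x) (contMDiff_chart_symm hc hns hα I _) ?_
  refine contMDiffAt_pi_space.2 fun i => ?_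
  have h1 : ContMDiffAt (𝓘(ℝ, Fin n → ℂ).prod 𝓘(ℝ, Fin n → ℂ)) 𝓘(ℝ, ℂ) ∞
      (fun p : Torus n × Δ.X => (chi (α I i) p.1 : ℂ)) (g, x) :=
    ContMDiffAt.comp (g := fun t : Torus n => (chi (α I i) t : ℂ)) (g, x)
      (contMDiff_coe_chi (α I i) g) contMDiffAt_fst
  have h2 : ContMDiffAt (𝓘(ℝ, Fin n → ℂ).prod 𝓘(ℝ, Fin n → ℂ)) 𝓘(ℝ, Fin n → ℂ) ∞
      (fun p : Torus n × Δ.X => e p.2) (g, x) :=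
    ((contMDiffOn_chart hc hns hα I).contMDiffAt (I.isOpen_domain.mem_nhds hx)).comp (g, x)
      contMDiffAt_snd
  have hmul : ContMDiff 𝓘(ℝ, ℂ × ℂ) 𝓘(ℝ, ℂ) ∞ fun p : ℂ × ℂ => p.1 * p.2 :=
    contDiff_mul.contMDiff
  exact (hmul _).comp (g, x) (h1.prodMk_space (contMDiffAt_pi_space.1 h2 i))

theorem isTopologicalToricManifold_X (hs : Function.Surjective Δ.lam) :
    letI := torusAction hs
    letI := chartedSpace hc hns hα
    IsTopologicalToricManifold n Δ.X := by
  let _ := torusAction hs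
  let _ := chartedSpace hc hns hα
  have hcomp := compactSpace_X hc hns
  have horb : MulAction.orbit (Torus n) (Δ.proj Δ.basePoint) =
      Set.range fun h : Torus m => Δ.proj (h • Δ.basePoint) := by
    refine Set.Subset.antisymm ?_ ?_
    · rintro _ ⟨g, rfl⟩
      obtain ⟨h, rfl⟩ := hs g
      exact ⟨h, (torusSMul_lam hs h _).symm⟩
    · rintro _ ⟨h, rfl⟩
      exact ⟨Δ.lam h, torusSMul_lam hs h _⟩
  refine ⟨t2Space_X hc hns, ChartedSpace.secondCountable_of_sigmaCompact (Fin n → ℂ) Δ.X, hcomp,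
    isManifold_X hc hns hα, contMDiff_torusAction hc hns hα hs, ⟨fun {g g'} hgg' => ?_⟩,
    ⟨Δ.proj Δ.basePoint, ?_, ?_⟩, ⟨Set.range fun I : Δ.Facet => I.domain, Set.finite_range _, ?_, ?_⟩⟩
  · obtain ⟨I⟩ := Δ.nonempty_facet
    have hfix : (g'⁻¹ * g) • Δ.proj (I.sect 1) = Δ.proj (I.sect 1) := by
      rw [mul_smul, hgg', inv_smul_smul]
    have h := (hα I).smul_mem_domain_and_chart_smul hns hs (g'⁻¹ * g)
      (Facet.proj_mem_domain_iff (z := I.sect 1) |>.2 (I.lift_mem 1))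
    rw [hfix] at h
    have hw : (hα I).chart hns (Δ.proj (I.sect 1)) = 1 := I.chartMap_lift (α I) 1
    have := (hα I).eq_one hns (g := g'⁻¹ * g) fun i => Units.ext (by simpa [hw] using (h.2 i).symm)
    exact (inv_mul_eq_one.1 this).symm
  · rw [horb]
    exact Δ.isOpen_range_proj_basePoint
  · rw [horb]
    exact Δ.denseRange_proj_basePoint
  · refine Set.eq_univ_of_forall fun x => ?_
    obtain ⟨I, hx⟩ := exists_mem_domain hc hns x
    exact ⟨_, ⟨I, rfl⟩, hx⟩
  · rintro _ ⟨I, rfl⟩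
    exact ⟨I.isOpen_domain,
      fun g x hx => ((hα I).smul_mem_domain_and_chart_smul hns hs g hx).1,
      fun i => chi (α I i), (hα I).chart hns, fun i => contMDiff_chi (α I i), rfl, rfl,
      contMDiffOn_chart hc hns hα I, contMDiff_chart_symm hc hns hα I,
      fun g x hx => ((hα I).smul_mem_domain_and_chart_smul hns hs g hx).2⟩

end Manifold

end TopologicalFan

end TopToric

end

theorem corollary6p3 {n m : ℕ} (Δ : TopToric.TopologicalFan n m)
    (hcomplete : Δ.IsComplete) (hnonsing : Δ.IsNonsingular) :
    -- `λ` is onto, so the action on `X(Δ)` below is determined by its first property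
    Function.Surjective Δ.lam ∧
    -- the family dual to `{βᵢ}`, `i ∈ I`, exists and is unique for every facet `I`
    (∀ I : Δ.Facet, ∃! α : Fin n → Fin n → TopToric.Exponent, I.IsDual α) ∧
    ∃ (α : Δ.Facet → Fin n → Fin n → TopToric.Exponent)
      (φ : Δ.Facet → OpenPartialHomeomorph Δ.X (Fin n → ℂ))
      (_ : MulAction (TopToric.Torus n) Δ.X)
      (_ : ChartedSpace (Fin n → ℂ) Δ.X),
      (∀ I : Δ.Facet, I.IsDual (α I)) ∧
      -- the action is induced from that of `(ℂ*)ᵐ` on `U(Σ)` through `λ`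
      (∀ (h : TopToric.Torus m) (z : Δ.U), Δ.lam h • Δ.proj z = Δ.proj (h • z)) ∧
      -- `φ_I` is a homeomorphism from `U(I) / Ker λ` onto `ℂ^I`, given by the formula
      (∀ I : Δ.Facet, (φ I).source = I.domain ∧ (φ I).target = Set.univ ∧
        ∀ z : Δ.U, (z : Fin m → ℂ) ∈ TopToric.TopologicalFan.coordOpen I.1 →
          φ I (Δ.proj z) = I.chartMap (α I) z) ∧
      -- it is equivariant onto the representation space of the `χ^{α^I_i}`
      (∀ I : Δ.Facet, ∀ g : TopToric.Torus n, ∀ x ∈ I.domain, g • x ∈ I.domain ∧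
        ∀ i, φ I (g • x) i = TopToric.chi (α I i) g * φ I x i) ∧
      -- that representation is faithful
      (∀ I : Δ.Facet, ∀ g : TopToric.Torus n, (∀ i, TopToric.chi (α I i) g = 1) → g = 1) ∧
      -- the transition maps are smooth
      (∀ I J : Δ.Facet, ContDiffOn ℝ ∞ (φ J ∘ (φ I).symm) (φ I '' (I.domain ∩ J.domain))) ∧
      -- the smooth structure is that of the charts `φ_I`
      atlas (Fin n → ℂ) Δ.X = Set.range φ ∧
      T2Space Δ.X ∧ CompactSpace Δ.X ∧
      TopToric.IsTopologicalToricManifold n Δ.X := by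
  obtain ⟨I₀⟩ := Δ.nonempty_facet
  have hs := I₀.lam_surjective hnonsing
  choose α hα using fun I : Δ.Facet => (I.existsUnique_isDual hnonsing).exists
  refine ⟨hs, fun I => I.existsUnique_isDual hnonsing, α, fun I => (hα I).chart hnonsing,
    TopToric.TopologicalFan.torusAction hs,
    TopToric.TopologicalFan.chartedSpace hcomplete hnonsing hα, hα,
    TopToric.TopologicalFan.torusSMul_lam hs, fun I => ⟨rfl, rfl, fun z _ => rfl⟩,
    fun I g x hx => (hα I).smul_mem_domain_and_chart_smul hnonsing hs g hx,
    fun I g hg => (hα I).eq_one hnonsing hg, fun I J => ?_, rfl,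
    TopToric.TopologicalFan.t2Space_X hcomplete hnonsing,
    TopToric.TopologicalFan.compactSpace_X hcomplete hnonsing,
    TopToric.TopologicalFan.isTopologicalToricManifold_X hcomplete hnonsing hα hs⟩
  refine (hα I).contDiffOn_transition (hα J) hnonsing ?_
  rintro _ ⟨x, ⟨hxI, hxJ⟩, rfl⟩
  rwa [((hα I).chart hnonsing).left_inv hxI]
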